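/- Fix an algebraic closure $\overline{\mathbb Q}$ of $\mathbb Q$, put $G_{\mathbb Q}=\mathrm{Gal}(\overline{\mathbb Q}/\mathbb Q)$, and choose $i,\sqrt2,\sqrt{1+i}\in\overline{\mathbb Q}$ with $i^2=-1$, $(\sqrt2)^2=2$, $(\sqrt{1+i})^2=1+i$. Let $K=\mathbb Q(i,\sqrt2,\sqrt{1+i})$; this is a Galois extension of $\mathbb Q$. Let $\mathrm{Gal}(K/\mathbb Q)\cong D_4=\langle r,s\mid r^4=s^2=1,\ srs=r^{-1}\rangle$ be the isomorphism for which the generators act by $$ri=-i,\quad r\sqrt2=-\sqrt2,\quad r\sqrt{1+i}=\tfrac{1-i}{\sqrt2}\sqrt{1+i},\qquad si=i,\quad s\sqrt2=-\sqrt2,\quad s\sqrt{1+i}=\sqrt{1+i},$$ and let $D_4\hookrightarrow\mathrm{GL}_2(\mathbb Z/4\mathbb Z)$ be the embedding $$r\mapsto\begin{pmatrix}1&2\\1&1\end{pmatrix},\qquad s\mapsto\begin{pmatrix}-1&2\\2&-1\end{pmatrix}.$$ Let $\rho$ be the composite $$\rho\colon G_{\mathbb Q}\twoheadrightarrow\mathrm{Gal}(K/\mathbb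 Q)\cong D_4\hookrightarrow\mathrm{GL}_2(\mathbb Z/4\mathbb Z).$$ Let $f=E_4^6\Delta+2\Delta^3$, a modular form of weight $36$ on $\mathrm{SL}_2(\mathbb Z)$, where $E_4=1+240\sum_{n\ge1}\big(\sum_{d\mid n}d^3\big)q^n$ and $\Delta=\sum_{n\ge1}\tau(n)q^n=q\prod_{n\ge1}(1-q^n)^{24}$, and let $a_n(f)$ be the coefficient of $q^n$ in the $q$-expansion of $f$ (with $q=e^{2\pi iz}$). Then $\rho$ is unramified at every odd prime $\ell$ (that is, unramified outside $2\cdot\infty$), and for every odd prime $\ell$ the coefficient $a_\ell(f)$ is an integer and $$\mathrm{Tr}\,\rho(\mathrm{Frob}_\ell)=\big(a_\ell(f)\bmod 4\big)$$ for every Frobenius element $\mathrm{Frob}_\ell\in G_{\mathbb Q}$ at $\ell$. -/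

import Mathlib

open scoped MatrixGroups

noncomputable section

set_option linter.unusedSectionVars false

namespace D4Galois

/-! ### The dihedral group of order 8 -/

/-- The homomorphism from `⟨r, s | r ^ 4 = s ^ 2 = 1, s r s = r⁻¹⟩` to a group `G` that is
determined by the images `r` and `s` of the two generators. -/
def dihedralLift {G : Type*} [Group G] (r s : G) (hr : r ^ 4 = 1) (hs : s ^ 2 = 1)
    (hsrs : s * r * s = r⁻¹) : DihedralGroup 4 →* G :=
  MonoidHom.mk'
    (fun g ↦ match g with
      | .r k => r ^ k.val
      | .sr k => s * r ^ k.val) (by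
    have hpow : ∀ a b : ZMod 4, r ^ (a + b).val = r ^ a.val * r ^ b.val := fun a b ↦ by
      rw [ZMod.val_add, ← pow_add]
      exact (pow_eq_pow_mod _ hr).symm
    have hss : s * s = 1 := by rw [← sq, hs]
    have hconj : ∀ n : ℕ, s * r ^ n * s = (r ^ n)⁻¹ := fun n ↦ by
      have h : s * r * s⁻¹ = r⁻¹ := by rw [inv_eq_of_mul_eq_one_right hss, hsrs]
      have h2 := conj_pow (i := n) (a := s) (b := r)
      rw [h, inv_eq_of_mul_eq_one_right hss] at h2
      rw [← h2, inv_pow]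
    have hsub : ∀ a b : ZMod 4, r ^ (b - a).val = (r ^ a.val)⁻¹ * r ^ b.val := fun a b ↦ by
      rw [eq_inv_mul_iff_mul_eq, ← hpow, add_sub_cancel]
    have hswap : ∀ n : ℕ, r ^ n * s = s * (r ^ n)⁻¹ := fun n ↦ by
      rw [← hconj n, ← mul_assoc, ← mul_assoc, hss, one_mul]
    rintro (a | a) (b | b)
    · exact hpow a b
    · change s * r ^ (b - a).val = r ^ a.val * (s * r ^ b.val)
      rw [hsub, ← mul_assoc, ← mul_assoc, hswap]
    · change s * r ^ (a + b).val = s * r ^ a.val * r ^ b.val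
      rw [hpow, mul_assoc]
    · change r ^ (b - a).val = s * r ^ a.val * (s * r ^ b.val)
      rw [hsub, ← mul_assoc, hconj])

/-! ### The embedding of the dihedral group in `GL₂(ℤ/4ℤ)` -/

/-- The image of `r`. -/
def matR : GL (Fin 2) (ZMod 4) := ⟨!![1, 2; 1, 1], !![-1, 2; 1, -1], by decide, by decide⟩

/-- The image of `s`. -/
def matS : GL (Fin 2) (ZMod 4) := ⟨!![-1, 2; 2, -1], !![-1, 2; 2, -1], by decide, by decide⟩

/-- The embedding `D₄ ↪ GL₂(ℤ/4ℤ)`. -/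
def matRep : DihedralGroup 4 →* GL (Fin 2) (ZMod 4) :=
  dihedralLift matR matS (by decide) (by decide) (by decide)

theorem matRep_injective : Function.Injective matRep := by
  rw [injective_iff_map_eq_one]
  decide

/-! ### The field `K = ℚ(i, √2, √(1 + i))` -/

/-- A choice, in an algebraic closure `Qbar` of `ℚ`, of the numbers denoted `i`, `√2`, `√(1 + i)`. -/
structure Radicals (Qbar : Type*) [Field Qbar] where
  /-- the number `i` -/
  i : Qbar
  /-- the number `√2` -/
  sqrtTwo : Qbar
  /-- the number `√(1 + i)` -/
  sqrtOneAddI : Qbar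
  i_sq : i ^ 2 = -1
  sqrtTwo_sq : sqrtTwo ^ 2 = 2
  sqrtOneAddI_sq : sqrtOneAddI ^ 2 = 1 + i

variable {Qbar : Type*} [Field Qbar] [Algebra ℚ Qbar] [IsAlgClosure ℚ Qbar]

instance : Nonempty (Radicals Qbar) := by
  have : IsAlgClosed Qbar := IsAlgClosure.isAlgClosed ℚ
  have : CharZero Qbar := algebraRat.charZero Qbar
  obtain ⟨i, hi⟩ := IsAlgClosed.exists_pow_nat_eq (-1 : Qbar) (n := 2) (by simp)
  obtain ⟨t, ht⟩ := IsAlgClosed.exists_pow_nat_eq (2 : Qbar) (n := 2) (by simp)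
  obtain ⟨g, hg⟩ := IsAlgClosed.exists_pow_nat_eq (1 + i) (n := 2) (by simp)
  exact ⟨⟨i, t, g, hi, ht, hg⟩⟩

namespace Radicals

variable (x : Radicals Qbar)

/-- The field `K = ℚ(i, √2, √(1 + i))`. -/
def K : IntermediateField ℚ (Qbar) :=
  IntermediateField.adjoin ℚ {x.i, x.sqrtTwo, x.sqrtOneAddI}

/-- `K` as an extension of `ℚ` inside `Qbar`; this only selects the instance to be used. -/
instance algebraK : Algebra ℚ x.K := IntermediateField.algebra' x.K

/-- `i` as an element of `K`. -/
def iK : x.K := ⟨x.i, IntermediateField.subset_adjoin _ _ (by simp)⟩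

/-- `√2` as an element of `K`. -/
def sqrtTwoK : x.K := ⟨x.sqrtTwo, IntermediateField.subset_adjoin _ _ (by simp)⟩

/-- `√(1 + i)` as an element of `K`. -/
def sqrtOneAddIK : x.K := ⟨x.sqrtOneAddI, IntermediateField.subset_adjoin _ _ (by simp)⟩

theorem iK_sq : x.iK ^ 2 = -1 := Subtype.ext x.i_sq

theorem sqrtTwoK_sq : x.sqrtTwoK ^ 2 = 2 := Subtype.ext x.sqrtTwo_sq

theorem sqrtOneAddIK_sq : x.sqrtOneAddIK ^ 2 = 1 + x.iK := Subtype.ext x.sqrtOneAddI_sq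

theorem sqrtTwo_ne_zero : x.sqrtTwo ≠ 0 := fun h ↦ by
  have : CharZero Qbar := algebraRat.charZero Qbar
  have := x.sqrtTwo_sq
  simp [h] at this

theorem sqrtOneAddI_ne_zero : x.sqrtOneAddI ≠ 0 := fun h ↦ by
  have : CharZero Qbar := algebraRat.charZero Qbar
  have h1 := x.sqrtOneAddI_sq
  have h2 := x.i_sq
  have h3 : x.i = -1 := by
    rw [h] at h1
    linear_combination -h1
  rw [h3] at h2
  norm_num at h2

theorem sqrtTwoK_ne_zero : x.sqrtTwoK ≠ 0 := fun h ↦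
  x.sqrtTwo_ne_zero (congrArg Subtype.val h)

theorem sqrtOneAddIK_ne_zero : x.sqrtOneAddIK ≠ 0 := fun h ↦
  x.sqrtOneAddI_ne_zero (congrArg Subtype.val h)

/-- The possible values of an automorphism on the generators. -/
theorem apply_cases (σ : Gal(Qbar/ℚ)) :
    (σ x.sqrtTwo = x.sqrtTwo ∨ σ x.sqrtTwo = -x.sqrtTwo) ∧
    ((σ x.i = x.i ∧
        (σ x.sqrtOneAddI = x.sqrtOneAddI ∨ σ x.sqrtOneAddI = -x.sqrtOneAddI)) ∨
      (σ x.i = -x.i ∧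
        (σ x.sqrtOneAddI = (1 - x.i) / x.sqrtTwo * x.sqrtOneAddI ∨
          σ x.sqrtOneAddI = -((1 - x.i) / x.sqrtTwo * x.sqrtOneAddI)))) := by
  have : CharZero Qbar := algebraRat.charZero Qbar
  have h2 := x.sqrtTwo_ne_zero
  refine ⟨?_, ?_⟩
  · rw [← sq_eq_sq_iff_eq_or_eq_neg, ← map_pow, x.sqrtTwo_sq, map_ofNat]
  · have hi : σ x.i = x.i ∨ σ x.i = -x.i := by
      rw [← sq_eq_sq_iff_eq_or_eq_neg, ← map_pow, x.i_sq, map_neg, map_one]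
    refine hi.imp (fun h ↦ ⟨h, ?_⟩) (fun h ↦ ⟨h, ?_⟩)
    · rw [← sq_eq_sq_iff_eq_or_eq_neg, ← map_pow, x.sqrtOneAddI_sq]
      simp [h]
    · rw [← sq_eq_sq_iff_eq_or_eq_neg, ← map_pow, mul_pow, div_pow, x.sqrtOneAddI_sq,
        x.sqrtTwo_sq, map_add, h, map_one]
      linear_combination (- (x.i - 1) / 2) * x.i_sq

instance normal_K : Normal ℚ x.K := by
  have : Normal ℚ Qbar := IsAlgClosure.normal ℚ Qbar
  rw [IntermediateField.normal_iff_forall_map_le']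
  intro σ
  rw [K, IntermediateField.adjoin_map, IntermediateField.adjoin_le_iff]
  have m1 := x.iK.2
  have m2 := x.sqrtTwoK.2
  have m3 := x.sqrtOneAddIK.2
  have m4 : (1 - x.i) / x.sqrtTwo * x.sqrtOneAddI ∈ x.K :=
    mul_mem (div_mem (sub_mem (one_mem _) m1) m2) m3
  obtain ⟨h2, h⟩ := x.apply_cases σ
  rintro _ ⟨y, (rfl | rfl | rfl), rfl⟩
  · change σ x.i ∈ x.K
    rcases h with ⟨h, -⟩ | ⟨h, -⟩ <;> rw [h]
    exacts [m1, neg_mem m1]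
  · change σ x.sqrtTwo ∈ x.K
    rcases h2 with h | h <;> rw [h]
    exacts [m2, neg_mem m2]
  · change σ x.sqrtOneAddI ∈ x.K
    rcases h with ⟨-, h | h⟩ | ⟨-, h | h⟩ <;> rw [h]
    exacts [m3, neg_mem m3, m4, neg_mem m4]

instance isGalois_K : IsGalois ℚ x.K where

/-- An automorphism of `K` is determined by its values on the generators. -/
theorem gal_ext {σ τ : Gal(x.K/ℚ)} (h1 : σ x.iK = τ x.iK) (h2 : σ x.sqrtTwoK = τ x.sqrtTwoK)
    (h3 : σ x.sqrtOneAddIK = τ x.sqrtOneAddIK) : σ = τ := by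
  have : σ.toAlgHom = τ.toAlgHom := by
    refine IntermediateField.algHom_ext_of_eq_adjoin ℚ (S := x.K) rfl ?_
    rintro y (rfl | rfl | rfl)
    exacts [h1, h2, h3]
  exact AlgEquiv.ext fun y ↦ DFunLike.congr_fun this y

/-- The possible values of an automorphism of `K` on the generators. -/
theorem apply_casesK (σ : Gal(x.K/ℚ)) :
    (σ x.sqrtTwoK = x.sqrtTwoK ∨ σ x.sqrtTwoK = -x.sqrtTwoK) ∧
    ((σ x.iK = x.iK ∧
        (σ x.sqrtOneAddIK = x.sqrtOneAddIK ∨ σ x.sqrtOneAddIK = -x.sqrtOneAddIK)) ∨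
      (σ x.iK = -x.iK ∧
        (σ x.sqrtOneAddIK = (1 - x.iK) / x.sqrtTwoK * x.sqrtOneAddIK ∨
          σ x.sqrtOneAddIK = -((1 - x.iK) / x.sqrtTwoK * x.sqrtOneAddIK)))) := by
  have : Normal ℚ Qbar := IsAlgClosure.normal ℚ Qbar
  obtain ⟨τ, rfl⟩ := AlgEquiv.restrictNormalHom_surjective (Qbar) σ
  simp only [Subtype.ext_iff, AlgEquiv.restrictNormalHom_apply]
  exact x.apply_cases τ

/-- Automorphisms with prescribed action on the eighth roots of unity. -/
theorem exists_zeta8 (k : ℕ) (hk : k.Coprime 8) : ∃ σ : Gal(Qbar/ℚ),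
    σ ((1 + x.i) / x.sqrtTwo) = ((1 + x.i) / x.sqrtTwo) ^ k := by
  have : CharZero Qbar := algebraRat.charZero Qbar
  have : Normal ℚ Qbar := IsAlgClosure.normal ℚ Qbar
  have h2 := x.sqrtTwo_ne_zero
  have hz2 : ((1 + x.i) / x.sqrtTwo) ^ 2 = x.i := by
    rw [div_pow, x.sqrtTwo_sq]
    linear_combination (1 / 2) * x.i_sq
  have hz4 : ((1 + x.i) / x.sqrtTwo) ^ 4 = -1 := by
    rw [show 4 = 2 * 2 from rfl, pow_mul, hz2, x.i_sq]
  have hprim : IsPrimitiveRoot ((1 + x.i) / x.sqrtTwo) 8 := by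
    have := IsPrimitiveRoot.orderOf ((1 + x.i) / x.sqrtTwo)
    rwa [show orderOf ((1 + x.i) / x.sqrtTwo) = 2 ^ (2 + 1) from
      orderOf_eq_prime_pow (by rw [show 2 ^ 2 = 4 from rfl, hz4]; norm_num)
        (by rw [show 2 ^ (2 + 1) = 4 * 2 from rfl, pow_mul, hz4]; norm_num)] at this
  have hmin : ∀ y : Qbar, IsPrimitiveRoot y 8 → minpoly ℚ y = Polynomial.cyclotomic 8 ℚ := by
    intro y hy
    rw [Polynomial.cyclotomic_eq_minpoly_rat hy (by norm_num)]
    congr 1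
    exact Subsingleton.elim _ _
  have hprim' := hprim.pow_of_coprime k hk
  obtain ⟨σ, hσ⟩ := minpoly.exists_algEquiv_of_root
    (K := ℚ) (x := (1 + x.i) / x.sqrtTwo) (y := ((1 + x.i) / x.sqrtTwo) ^ k)
    (Algebra.IsAlgebraic.isAlgebraic _) (by
      rw [hmin _ hprim', ← hmin _ hprim, minpoly.aeval])
  exact ⟨σ, hσ⟩

theorem exists_conj_K (k : ℕ) (hk : k.Coprime 8) : ∃ σ : Gal(x.K/ℚ),
    σ x.iK = x.iK ^ k ∧
      σ ((1 + x.iK) / x.sqrtTwoK) = ((1 + x.iK) / x.sqrtTwoK) ^ k := by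
  obtain ⟨σ, hσ⟩ := x.exists_zeta8 k hk
  have h : AlgEquiv.restrictNormalHom x.K σ ((1 + x.iK) / x.sqrtTwoK)
      = ((1 + x.iK) / x.sqrtTwoK) ^ k := by
    rw [Subtype.ext_iff, AlgEquiv.restrictNormalHom_apply]
    exact hσ
  refine ⟨AlgEquiv.restrictNormalHom x.K σ, ?_, h⟩
  have hz2 : x.iK = ((1 + x.iK) / x.sqrtTwoK) ^ 2 := by
    have h2 := x.sqrtTwoK_ne_zero
    have h3 := x.sqrtTwoK_sq
    have h4 := x.iK_sq
    rw [div_pow, eq_div_iff (pow_ne_zero 2 h2), h3]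
    linear_combination -h4
  rw [hz2, map_pow, h, ← pow_mul, ← pow_mul, mul_comm]

theorem two_ne_zeroK : (2 : x.K) ≠ 0 := by
  have : CharZero x.K := algebraRat.charZero x.K
  exact two_ne_zero

theorem iK_ne_neg : x.iK ≠ -x.iK := fun h ↦ by
  have h1 := x.iK_sq
  have h2 := x.two_ne_zeroK
  grind

theorem sqrtTwoK_ne_neg : x.sqrtTwoK ≠ -x.sqrtTwoK := fun h ↦ by
  have h1 := x.sqrtTwoK_ne_zero
  have h2 := x.two_ne_zeroK
  grind

theorem sqrtOneAddIK_ne_neg : x.sqrtOneAddIK ≠ -x.sqrtOneAddIK := fun h ↦ by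
  have h1 := x.sqrtOneAddIK_ne_zero
  have h2 := x.two_ne_zeroK
  grind

/-- There is an automorphism of `K` acting as `r` is required to. -/
theorem exists_autR : ∃ r : Gal(x.K/ℚ), r x.iK = -x.iK ∧ r x.sqrtTwoK = -x.sqrtTwoK ∧
    r x.sqrtOneAddIK = (1 - x.iK) / x.sqrtTwoK * x.sqrtOneAddIK := by
  have h2 := x.sqrtTwoK_ne_zero
  have h3 := x.sqrtTwoK_sq
  have h4 := x.iK_sq
  obtain ⟨σ, hi, hz⟩ := x.exists_conj_K 3 (by norm_num)
  have hi' : σ x.iK = -x.iK := by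
    rw [hi]
    linear_combination x.iK * h4
  have ht : σ x.sqrtTwoK = -x.sqrtTwoK := by
    have ht0 : σ x.sqrtTwoK ≠ 0 := by simpa using h2
    rw [map_div₀, map_add, map_one, hi'] at hz
    grind
  rcases (x.apply_casesK σ).2 with ⟨h, -⟩ | ⟨-, h | h⟩
  · exact absurd (h.symm.trans hi') x.iK_ne_neg
  · exact ⟨σ, hi', ht, h⟩
  · refine ⟨σ * σ * σ, ?_, ?_, ?_⟩
    · simp [hi']
    · simp [ht]
    · simp only [AlgEquiv.mul_apply, h, map_neg, map_mul, map_div₀, map_sub, map_one, hi', ht]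
      grind

/-- There is an automorphism of `K` acting as `s` is required to. -/
theorem exists_autS : ∃ s : Gal(x.K/ℚ), s x.iK = x.iK ∧ s x.sqrtTwoK = -x.sqrtTwoK ∧
    s x.sqrtOneAddIK = x.sqrtOneAddIK := by
  have h2 := x.sqrtTwoK_ne_zero
  have h3 := x.sqrtTwoK_sq
  have h4 := x.iK_sq
  obtain ⟨r, hri, hrt, hrg⟩ := x.exists_autR
  obtain ⟨σ, hi, hz⟩ := x.exists_conj_K 5 (by norm_num)
  have hi' : σ x.iK = x.iK := by
    rw [hi]
    linear_combination (x.iK ^ 3 - x.iK) * h4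
  have ht : σ x.sqrtTwoK = -x.sqrtTwoK := by
    have ht0 : σ x.sqrtTwoK ≠ 0 := by simpa using h2
    rw [map_div₀, map_add, map_one, hi'] at hz
    grind
  rcases (x.apply_casesK σ).2 with ⟨-, h | h⟩ | ⟨h, -⟩
  · exact ⟨σ, hi', ht, h⟩
  · refine ⟨r * r * σ, ?_, ?_, ?_⟩
    · simp [hi', hri]
    · simp [ht, hrt]
    · simp only [AlgEquiv.mul_apply, h, map_neg, map_mul, map_div₀, map_sub, map_one, hri, hrt, hrg]
      grind
  · exact absurd (hi'.symm.trans h) x.iK_ne_neg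

/-- The automorphism `r` of `K`. -/
def autR : Gal(x.K/ℚ) := x.exists_autR.choose

/-- The automorphism `s` of `K`. -/
def autS : Gal(x.K/ℚ) := x.exists_autS.choose

theorem autR_spec : x.autR x.iK = -x.iK ∧ x.autR x.sqrtTwoK = -x.sqrtTwoK ∧
    x.autR x.sqrtOneAddIK = (1 - x.iK) / x.sqrtTwoK * x.sqrtOneAddIK := x.exists_autR.choose_spec

theorem autS_spec : x.autS x.iK = x.iK ∧ x.autS x.sqrtTwoK = -x.sqrtTwoK ∧
    x.autS x.sqrtOneAddIK = x.sqrtOneAddIK := x.exists_autS.choose_spec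

theorem autR_sq_apply : x.autR (x.autR x.sqrtOneAddIK) = -x.sqrtOneAddIK := by
  obtain ⟨hi, ht, hg⟩ := x.autR_spec
  have h2 := x.sqrtTwoK_ne_zero
  have h3 := x.sqrtTwoK_sq
  have h4 := x.iK_sq
  simp only [hg, map_mul, map_div₀, map_sub, map_one, hi, ht]
  grind

theorem autR_pow_four : x.autR ^ 4 = 1 := by
  obtain ⟨hi, ht, hg⟩ := x.autR_spec
  have hg2 := x.autR_sq_apply
  refine x.gal_ext ?_ ?_ ?_
  · simp [pow_succ, hi]
  · simp [pow_succ, ht]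
  · simp only [pow_succ, pow_zero, one_mul, AlgEquiv.mul_apply, hg2, map_neg, neg_neg,
      AlgEquiv.one_apply]

theorem autS_sq : x.autS ^ 2 = 1 := by
  obtain ⟨hi, ht, hg⟩ := x.autS_spec
  refine x.gal_ext ?_ ?_ ?_ <;> simp [sq, hi, ht, hg]

theorem autS_mul_autR_mul_autS : x.autS * x.autR * x.autS = x.autR⁻¹ := by
  obtain ⟨hi, ht, hg⟩ := x.autR_spec
  obtain ⟨hi', ht', hg'⟩ := x.autS_spec
  have hg2 := x.autR_sq_apply
  rw [eq_inv_iff_mul_eq_one]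
  refine x.gal_ext ?_ ?_ ?_
  · simp [hi, hi']
  · simp [ht, ht']
  · have h2 := x.sqrtTwoK_ne_zero
    have h3 := x.sqrtTwoK_sq
    have h4 := x.iK_sq
    simp only [AlgEquiv.mul_apply, AlgEquiv.one_apply, hg, hg', map_mul, map_div₀, map_sub,
      map_one, hi, hi', ht, ht', map_neg]
    grind

/-- The homomorphism `D₄ → Gal(K/ℚ)` given by the automorphisms `r` and `s`. -/
def dihedralToGal : DihedralGroup 4 →* Gal(x.K/ℚ) :=
  dihedralLift x.autR x.autS x.autR_pow_four x.autS_sq x.autS_mul_autR_mul_autS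

theorem dihedralToGal_bijective : Function.Bijective x.dihedralToGal := by
  obtain ⟨hi, ht, hg⟩ := x.autR_spec
  obtain ⟨hi', ht', hg'⟩ := x.autS_spec
  have hg2 := x.autR_sq_apply
  have n1 := x.iK_ne_neg
  have n2 := x.sqrtTwoK_ne_neg
  have n3 := x.sqrtOneAddIK_ne_neg
  have r0 : x.dihedralToGal (.r 0) = 1 := rfl
  have r1 : x.dihedralToGal (.r 1) = x.autR := pow_one _
  have r2 : x.dihedralToGal (.r 2) = x.autR * x.autR := pow_two _
  have r3 : x.dihedralToGal (.r 3) = x.autR * x.autR * x.autR := pow_three' _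
  have s0 : x.dihedralToGal (.sr 0) = x.autS := mul_one _
  have s1 : x.dihedralToGal (.sr 1) = x.autS * x.autR := congrArg (x.autS * ·) (pow_one _)
  have s2 : x.dihedralToGal (.sr 2) = x.autS * (x.autR * x.autR) :=
    congrArg (x.autS * ·) (pow_two _)
  have s3 : x.dihedralToGal (.sr 3) = x.autS * (x.autR * x.autR * x.autR) :=
    congrArg (x.autS * ·) (pow_three' _)
  constructor
  · rw [injective_iff_map_eq_one]
    rintro (k | k) h
    · fin_cases k
      · rfl
      · have := DFunLike.congr_fun (r1.symm.trans h) x.iK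
        simp [hi, n1.symm] at this
      · have := DFunLike.congr_fun (r2.symm.trans h) x.sqrtOneAddIK
        simp [hg2, n3.symm] at this
      · have := DFunLike.congr_fun (r3.symm.trans h) x.iK
        simp [hi, n1.symm] at this
    · fin_cases k
      · have := DFunLike.congr_fun (s0.symm.trans h) x.sqrtTwoK
        simp [ht', n2.symm] at this
      · have := DFunLike.congr_fun (s1.symm.trans h) x.iK
        simp [hi, hi', n1.symm] at this
      · have := DFunLike.congr_fun (s2.symm.trans h) x.sqrtTwoK
        simp [ht, ht', n2.symm] at this
      · have := DFunLike.congr_fun (s3.symm.trans h) x.iK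
        simp [hi, hi', n1.symm] at this
  · intro σ
    obtain ⟨h2, h⟩ := x.apply_casesK σ
    rcases h2 with h2 | h2 <;> rcases h with ⟨h1, h3 | h3⟩ | ⟨h1, h3 | h3⟩
    · exact ⟨.r 0, r0.trans (x.gal_ext h1.symm h2.symm h3.symm)⟩
    · refine ⟨.r 2, r2.trans (x.gal_ext ?_ ?_ ?_)⟩
      · simp [h1, hi]
      · simp [h2, ht]
      · simp [h3, hg2]
    · refine ⟨.sr 3, s3.trans (x.gal_ext ?_ ?_ ?_)⟩
      · simp [h1, hi, hi']
      · simp [h2, ht, ht']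
      · rw [AlgEquiv.mul_apply, AlgEquiv.mul_apply, AlgEquiv.mul_apply, hg2]
        simp only [h3, hg, map_neg, map_mul, map_div₀, map_sub, map_one, hi', ht', hg']
        ring
    · refine ⟨.sr 1, s1.trans (x.gal_ext ?_ ?_ ?_)⟩
      · simp [h1, hi, hi']
      · simp [h2, ht, ht']
      · simp only [AlgEquiv.mul_apply, h3, hg, map_mul, map_div₀, map_sub,
          map_one, hi', ht', hg']
        ring
    · exact ⟨.sr 0, s0.trans (x.gal_ext (hi'.trans h1.symm) (ht'.trans h2.symm)
        (hg'.trans h3.symm))⟩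
    · refine ⟨.sr 2, s2.trans (x.gal_ext ?_ ?_ ?_)⟩
      · simp [h1, hi, hi']
      · simp [h2, ht, ht']
      · simp [h3, hg2, hg']
    · exact ⟨.r 1, r1.trans (x.gal_ext (hi.trans h1.symm) (ht.trans h2.symm)
        (hg.trans h3.symm))⟩
    · refine ⟨.r 3, r3.trans (x.gal_ext ?_ ?_ ?_)⟩
      · simp [h1, hi]
      · simp [h2, ht]
      · simp only [AlgEquiv.mul_apply, hg2, h3]
        rw [← hg, map_neg]

/-- The isomorphism `Gal(K/ℚ) ≅ D₄`, for which the generators `r` and `s` act by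
`r i = -i`, `r √2 = -√2`, `r √(1 + i) = ((1 - i) / √2) √(1 + i)` and
`s i = i`, `s √2 = -√2`, `s √(1 + i) = √(1 + i)`. -/
def galEquiv : Gal(x.K/ℚ) ≃* DihedralGroup 4 :=
  (MulEquiv.ofBijective x.dihedralToGal x.dihedralToGal_bijective).symm

theorem galEquiv_autR : x.galEquiv x.autR = .r 1 :=
  (MulEquiv.symm_apply_eq _).2 (pow_one _).symm

theorem galEquiv_autS : x.galEquiv x.autS = .sr 0 :=
  (MulEquiv.symm_apply_eq _).2 (mul_one _).symm

/-- The representation `ρ : G_ℚ ↠ Gal(K/ℚ) ≅ D₄ ↪ GL₂(ℤ/4ℤ)`. -/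
def rho : Gal(Qbar/ℚ) →* GL (Fin 2) (ZMod 4) :=
  matRep.comp (x.galEquiv.toMonoidHom.comp (AlgEquiv.restrictNormalHom x.K))

end Radicals
/-! ### Unramified representations, Frobenius elements, and the modular form -/

open NumberField in
/-- A representation of `G_ℚ` is unramified at `ℓ` if it is trivial on the inertia group of
every prime of the ring of all algebraic integers that lies above `ℓ`. -/
def IsUnramifiedAt {G : Type*} [Group G] (ρ : Gal(Qbar/ℚ) →* G) (ℓ : ℕ) : Prop :=
  ∀ Q : Ideal (𝓞 Qbar), Q.IsPrime → Q.LiesOver (Ideal.span {(ℓ : ℤ)}) →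
    Q.inertia Gal(Qbar/ℚ) ≤ ρ.ker

open NumberField in
/-- `σ` is a Frobenius element at `ℓ`: there is a prime `Q` above `ℓ` of the ring of all algebraic
integers such that `σ x ≡ x ^ ℓ (mod Q)` for all algebraic integers `x`. -/
def IsFrobeniusAt (σ : Gal(Qbar/ℚ)) (ℓ : ℕ) : Prop :=
  ∃ Q : Ideal (𝓞 Qbar), Q.IsPrime ∧ Q.LiesOver (Ideal.span {(ℓ : ℤ)}) ∧ IsArithFrobAt ℤ σ Q

/-- The modular form `f = E₄ ^ 6 Δ + 2 Δ ^ 3` of weight 36 on `SL₂(ℤ)`. -/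
def f : ModularForm 𝒮ℒ 36 :=
  ModularForm.mcast (by norm_num)
      ((ModularForm.E₄.pow 6).mul (CuspForm.toModularFormₗ CuspForm.discriminant)) +
    (2 : ℂ) • ModularForm.mcast (by norm_num)
      ((CuspForm.toModularFormₗ CuspForm.discriminant).pow 3)

/-- The coefficient `a_n(h)` of `q ^ n` in the `q`-expansion of `h`. -/
def a {k : ℤ} (n : ℕ) (h : ModularForm 𝒮ℒ k) : ℂ := (UpperHalfPlane.qExpansion 1 h).coeff n

end D4Galois

end

/-!
Both sides of the trace identity depend only on `ℓ` modulo `8`: they are `0` if `ℓ ≡ 7` and `2`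
otherwise.

On the Galois side, the trace on `D₄ ⊆ GL₂(ℤ/4ℤ)` vanishes exactly at the two elements acting by
`i ↦ -i`, `√2 ↦ √2` (`dihedralToGal_apply_iff`). Such an element is recognised on the eighth roots
of unity, where a Frobenius element at `ℓ` acts as the `ℓ`-th power (`apply_of_isFrobeniusAt`).
The representation `ρ` is trivial on inertia at `ℓ` because an automorphism moving one of `i`, `√2`,
`√(1 + i)` changes one of them by a sign, and twice that number divides a power of `2`.

On the modular side, `f ≡ Δ + 2 Δ³` modulo `4`. Write `A = ∑ σ₃(n) qⁿ`. From
`1728 Δ = E₄³ - E₆²` the series `Δ` is, modulo `4`, a divisor sum plus `A²`, and the identity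
`E₄² = E₈` shows that `120 A² = ∑ (σ₇(n) - σ₃(n)) qⁿ`. Hence the coefficients of `Δ` modulo `4` are
the divisor sums of one explicit polynomial (`deltaSeries_eq`), which gives `τ(ℓ) ≡ 1 + ℓ` modulo
`4`, and shows that modulo `2` the series `Δ` is supported on exponents `≡ 1` modulo `8`.

Modulo `2` one has `Δ³ = Δ(q) Δ(q²)`, so the coefficient of `q^ℓ` vanishes unless `ℓ ≡ 3` modulo
`8`. If `ℓ ≡ 3` modulo `8`, it has the parity of half the coefficient of `q^ℓ` in `A²`, that is of
`(ℓ⁷ - ℓ³) / 240`, which is odd (`deltaSeries_cube_coeff_prime`). So no result on the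
representation of primes by quadratic forms is needed.
-/

namespace D4Galois

section

open PowerSeries Finset

/-! ### Divisor sums as power series -/

/-- The power series `∑ (∑ d ∣ n, h d) q ^ n` over `n ≥ 1`; the constant term is `0` because
`Nat.divisors 0` is empty. -/
noncomputable def divisorSeries (h : ℕ → ℤ) : ℤ⟦X⟧ := .mk fun n ↦ ∑ d ∈ n.divisors, h d

theorem coeff_divisorSeries (h : ℕ → ℤ) (n : ℕ) :
    (divisorSeries h).coeff n = ∑ d ∈ n.divisors, h d := coeff_mk _ _

theorem divisorSeries_add (g h : ℕ → ℤ) :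
    divisorSeries (fun d ↦ g d + h d) = divisorSeries g + divisorSeries h := by
  ext n
  simp [coeff_divisorSeries, sum_add_distrib]

theorem divisorSeries_const_mul (c : ℤ) (h : ℕ → ℤ) :
    divisorSeries (fun d ↦ c * h d) = C c * divisorSeries h := by
  ext n
  rw [coeff_C_mul, coeff_divisorSeries, coeff_divisorSeries, mul_sum]

/-- The series `∑ σ_k(n) q ^ n`. -/
noncomputable def sigmaSeries (k : ℕ) : ℤ⟦X⟧ := divisorSeries fun d ↦ (d : ℤ) ^ k

theorem coeff_sigmaSeries (k n : ℕ) :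
    (sigmaSeries k).coeff n = ∑ d ∈ n.divisors, (d : ℤ) ^ k := coeff_divisorSeries _ _

/-- The series `E₄ = 1 + 240 ∑ σ₃(n) q ^ n`. -/
noncomputable def e4Series : ℤ⟦X⟧ := 1 + 240 * sigmaSeries 3

/-- The series `E₆ = 1 - 504 ∑ σ₅(n) q ^ n`. -/
noncomputable def e6Series : ℤ⟦X⟧ := 1 - 504 * sigmaSeries 5

/-- The series `E₈ = 1 + 480 ∑ σ₇(n) q ^ n`. -/
noncomputable def e8Series : ℤ⟦X⟧ := 1 + 480 * sigmaSeries 7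

theorem twelve_dvd (d : ℤ) : 12 ∣ 5 * d ^ 3 + 7 * d ^ 5 := by
  rw [show (12 : ℤ) = (12 : ℕ) from rfl, ← ZMod.intCast_zmod_eq_zero_iff_dvd _ 12]
  push_cast
  generalize (d : ZMod 12) = e
  revert e
  decide

/-- The series `(E₄ ^ 3 - E₆ ^ 2) / 1728`, written so that its coefficients are visibly integers:
the part of the numerator linear in the divisor sums is `144 ∑ (5 σ₃(n) + 7 σ₅(n)) q ^ n`. -/
noncomputable def deltaSeries : ℤ⟦X⟧ :=
  divisorSeries (fun d ↦ (5 * (d : ℤ) ^ 3 + 7 * (d : ℤ) ^ 5) / 12) +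
    100 * sigmaSeries 3 ^ 2 + 8000 * sigmaSeries 3 ^ 3 - 147 * sigmaSeries 5 ^ 2

theorem twelve_mul_divisorSeries :
    12 * divisorSeries (fun d ↦ (5 * (d : ℤ) ^ 3 + 7 * (d : ℤ) ^ 5) / 12) =
      5 * sigmaSeries 3 + 7 * sigmaSeries 5 := by
  have h (c : ℤ) (g : ℕ → ℤ) := divisorSeries_const_mul c g
  have h12 := h 12 fun d ↦ (5 * (d : ℤ) ^ 3 + 7 * (d : ℤ) ^ 5) / 12
  have h5 := h 5 fun d ↦ (d : ℤ) ^ 3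
  have h7 := h 7 fun d ↦ (d : ℤ) ^ 5
  simp only [Int.mul_ediv_cancel' (twelve_dvd _), divisorSeries_add, h5, h7] at h12
  simpa [sigmaSeries] using h12.symm

theorem mul_deltaSeries : 1728 * deltaSeries = e4Series ^ 3 - e6Series ^ 2 := by
  rw [deltaSeries, e4Series, e6Series]
  linear_combination 144 * twelve_mul_divisorSeries

/-! ### The divisor weight of `Δ` modulo `4` -/

/-- The polynomial `(5 d³ + 7 d⁵) / 12 + (d⁷ - d³) / 120`, integer-valued on the integers. Its
divisor sums are the coefficients of `Δ` modulo `4`. -/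
def deltaWeight (d : ℕ) : ℤ := ((d : ℤ) ^ 7 + 70 * (d : ℤ) ^ 5 + 49 * (d : ℤ) ^ 3) / 120

theorem mul_deltaWeight (d : ℕ) :
    120 * deltaWeight d = (d : ℤ) ^ 7 + 70 * (d : ℤ) ^ 5 + 49 * (d : ℤ) ^ 3 := by
  refine Int.mul_ediv_cancel' ?_
  rw [show (120 : ℤ) = (120 : ℕ) from rfl, ← ZMod.intCast_zmod_eq_zero_iff_dvd _ 120]
  push_cast
  generalize (d : ZMod 120) = e
  revert e
  decide +kernel

theorem deltaWeight_of_odd {d : ℕ} (hd : Odd d) : (deltaWeight d : ZMod 4) = d := by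
  have key : ∀ e : ZMod 32, e.val % 2 = 1 → e ^ 7 + 70 * e ^ 5 + 49 * e ^ 3 = 120 * e := by
    decide +kernel
  -- Since `120 = 8 * 15`, the value modulo `4` is determined by `d` modulo `32`.
  have h := key d (by
    rw [ZMod.val_natCast, Nat.mod_mod_of_dvd _ (by norm_num)]
    exact Nat.odd_iff.1 hd)
  have h2 : ((120 * (deltaWeight d - d) : ℤ) : ZMod 32) = 0 := by
    rw [mul_sub, mul_deltaWeight]
    push_cast
    rw [h, sub_self]
  rw [ZMod.intCast_zmod_eq_zero_iff_dvd] at h2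
  have h3 : ((deltaWeight d - d : ℤ) : ZMod 4) = 0 := by
    rw [ZMod.intCast_zmod_eq_zero_iff_dvd]
    push_cast at h2 ⊢
    omega
  push_cast at h3
  exact sub_eq_zero.1 h3

theorem deltaWeight_mod_two (d : ℕ) : (deltaWeight d : ZMod 2) = if 4 ∣ d then 0 else 1 := by
  have key : ∀ e : ZMod 16, e ^ 7 + 70 * e ^ 5 + 49 * e ^ 3 = if e.val % 4 = 0 then 0 else 8 := by
    decide +kernel
  have h := key d
  simp only [ZMod.val_natCast, Nat.mod_mod_of_dvd _ (show 4 ∣ 16 by norm_num),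
    ← Nat.dvd_iff_mod_eq_zero] at h
  have h2 : ((120 * deltaWeight d - if 4 ∣ d then 0 else 8 : ℤ) : ZMod 16) = 0 := by
    rw [mul_deltaWeight]
    push_cast
    rw [h, sub_self]
  rw [ZMod.intCast_zmod_eq_zero_iff_dvd] at h2
  have h3 : ((deltaWeight d - if 4 ∣ d then 0 else 1 : ℤ) : ZMod 2) = 0 := by
    rw [ZMod.intCast_zmod_eq_zero_iff_dvd]
    split_ifs at h2 ⊢ <;> push_cast at h2 ⊢ <;> omega
  push_cast at h3
  exact sub_eq_zero.1 h3

end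

section

open PowerSeries ModularForm

/-! ### Integral `q`-expansions -/

theorem map_one_add_mul_sigmaSeries {k : ℕ} (hk : 3 ≤ k) (hk2 : Even k) (c : ℤ)
    (hc : -(2 * k / bernoulli k : ℂ) = c) :
    (1 + C c * sigmaSeries (k - 1)).map (Int.castRingHom ℂ) =
      UpperHalfPlane.qExpansion 1 (E hk) := by
  ext n
  rw [EisensteinSeries.E_qExpansion_coeff hk hk2, hc, coeff_map, map_add, coeff_C_mul,
    coeff_sigmaSeries, coeff_one]
  split_ifs with h
  · simp [h]
  · simp [ArithmeticFunction.sigma_apply]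

theorem qExpansion_E₄ :
    e4Series.map (Int.castRingHom ℂ) = UpperHalfPlane.qExpansion 1 E₄ := by
  rw [← map_one_add_mul_sigmaSeries (by norm_num) ⟨2, rfl⟩ 240
    (by norm_num [show bernoulli 4 = -1 / 30 by decide +kernel]), map_ofNat]
  rfl

theorem qExpansion_E₆ :
    e6Series.map (Int.castRingHom ℂ) = UpperHalfPlane.qExpansion 1 E₆ := by
  rw [← map_one_add_mul_sigmaSeries (by norm_num) ⟨3, rfl⟩ (-504)
    (by norm_num [show bernoulli 6 = 1 / 42 by decide +kernel]), map_neg, map_ofNat, neg_mul,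
    ← sub_eq_add_neg]
  rfl

theorem qExpansion_E₈ : e8Series.map (Int.castRingHom ℂ) =
    UpperHalfPlane.qExpansion 1 (E (by norm_num : 3 ≤ 8)) := by
  rw [← map_one_add_mul_sigmaSeries (by norm_num) ⟨4, rfl⟩ 480
    (by norm_num [show bernoulli 8 = -1 / 30 by decide +kernel]), map_ofNat]
  rfl

theorem map_castRingHom_injective :
    Function.Injective (PowerSeries.map (Int.castRingHom ℂ)) :=
  PowerSeries.map_injective _ Int.cast_injective

/-- Both sides are `q`-expansions of modular forms of weight `8` with constant term `1`, and there
are no cusp forms in weight `8`. -/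
theorem e8Series_eq : e8Series = e4Series ^ 2 := by
  have hz : E (by norm_num : 3 ≤ 8) - ModularForm.mcast (by norm_num) (E₄.pow 2) = 0 := by
    refine ModularForm.sturm_bound_levelOne ?_
    rw [FunLike.coe_sub, ModularForm.qExpansion_sub one_pos one_mem_strictPeriods_SL,
      ModularForm.qExpansion_mcast, ModularForm.qExpansion_pow one_pos one_mem_strictPeriods_SL,
      ← qExpansion_E₄, ← qExpansion_E₈, ← map_pow, ← map_sub]
    refine lt_of_lt_of_le (b := (1 : ℕ∞)) (by norm_num) (nat_le_order _ 1 fun i hi ↦ ?_)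
    obtain rfl : i = 0 := by omega
    have h0 (k : ℕ) : constantCoeff (sigmaSeries k) = 0 := by
      rw [← coeff_zero_eq_constantCoeff_apply, coeff_sigmaSeries, Nat.divisors_zero,
        Finset.sum_empty]
    rw [coeff_map, coeff_zero_eq_constantCoeff_apply, e8Series, e4Series, map_sub, map_pow,
      map_add, map_add, map_mul, map_mul, h0, h0]
    simp
  apply map_castRingHom_injective
  rw [map_pow, qExpansion_E₄, qExpansion_E₈, sub_eq_zero.1 hz, ModularForm.qExpansion_mcast,
    ModularForm.qExpansion_pow one_pos one_mem_strictPeriods_SL]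

theorem qExpansion_discriminant : deltaSeries.map (Int.castRingHom ℂ) =
    UpperHalfPlane.qExpansion 1 (CuspForm.toModularFormₗ CuspForm.discriminant) := by
  set Δ := CuspForm.toModularFormₗ CuspForm.discriminant with hΔ
  have h : (1728 : ℂ) • Δ =
      ModularForm.mcast (by norm_num) (E₄.pow 3) - ModularForm.mcast (by norm_num) (E₆.pow 2) := by
    ext z
    have h1 := ModularForm.discriminant_eq_E₄_cube_sub_E₆_sq z
    have h2 : Δ z = ModularForm.discriminant z := rfl
    change (1728 : ℂ) * Δ z = (E₄.pow 3) z - (E₆.pow 2) z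
    rw [ModularForm.coe_pow, ModularForm.coe_pow, h2, h1]
    simp only [Pi.pow_apply]
    ring
  have hq := congrArg (fun g : ModularForm 𝒮ℒ 12 ↦ UpperHalfPlane.qExpansion 1 g) h
  simp only [FunLike.coe_sub, FunLike.coe_smul,
    ModularForm.qExpansion_sub one_pos one_mem_strictPeriods_SL,
    ModularForm.qExpansion_smul one_pos one_mem_strictPeriods_SL,
    ModularForm.qExpansion_mcast, ModularForm.qExpansion_pow one_pos one_mem_strictPeriods_SL,
    ← qExpansion_E₄, ← qExpansion_E₆, ← map_pow, ← map_sub, ← mul_deltaSeries] at hq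
  ext n
  have hn := congrArg (coeff n) hq
  rw [map_mul, map_ofNat, show (1728 : ℂ⟦X⟧) = C 1728 from (map_ofNat C 1728).symm, coeff_C_mul,
    PowerSeries.coeff_smul, smul_eq_mul] at hn
  exact (mul_left_cancel₀ (by norm_num) hn).symm

/-- The `q`-expansion of `f`, as a power series with integer coefficients. -/
noncomputable def fSeries : ℤ⟦X⟧ := e4Series ^ 6 * deltaSeries + 2 * deltaSeries ^ 3

theorem qExpansion_f : fSeries.map (Int.castRingHom ℂ) = UpperHalfPlane.qExpansion 1 f := by
  rw [f, FunLike.coe_add, ModularForm.qExpansion_add one_pos one_mem_strictPeriods_SL,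
    FunLike.coe_smul,
    ModularForm.qExpansion_smul one_pos one_mem_strictPeriods_SL, ModularForm.qExpansion_mcast,
    ModularForm.qExpansion_mcast, ModularForm.qExpansion_mul one_pos one_mem_strictPeriods_SL,
    ModularForm.qExpansion_pow one_pos one_mem_strictPeriods_SL,
    ModularForm.qExpansion_pow one_pos one_mem_strictPeriods_SL, ← qExpansion_E₄,
    ← qExpansion_discriminant, fSeries, smul_eq_C_mul, map_ofNat, map_add, map_mul, map_mul,
    map_pow, map_pow, map_ofNat]

theorem a_f (n : ℕ) : a n f = (fSeries.coeff n : ℤ) := by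
  rw [a, ← qExpansion_f, coeff_map]
  rfl

end

section

open PowerSeries Finset

/-! ### Congruences for the coefficients of `Δ` and `f` -/

/-- The identity `E₄ ^ 2 = E₈` on the level of divisor sums. -/
theorem mul_sigmaSeries_sq :
    120 * sigmaSeries 3 ^ 2 = sigmaSeries 7 - sigmaSeries 3 := by
  have h : (480 : ℤ⟦X⟧) ≠ 0 := fun h ↦ by
    have h0 := congrArg constantCoeff h
    rw [map_ofNat, map_zero] at h0
    norm_num at h0
  refine mul_left_cancel₀ h ?_
  have h8 := e8Series_eq
  rw [e8Series, e4Series] at h8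
  linear_combination -h8
/-- Modulo `4`, the convolution terms in `Δ` combine to `(∑ σ₃(n) q ^ n) ^ 2`, which the identity
`E₄ ^ 2 = E₈` turns into a divisor sum. -/
theorem deltaSeries_eq :
    ∃ Y : ℤ⟦X⟧, deltaSeries = divisorSeries deltaWeight + 4 * Y := by
  obtain ⟨Z, hZ⟩ : ∃ Z : ℤ⟦X⟧, sigmaSeries 5 = sigmaSeries 3 + 2 * Z := by
    refine ⟨divisorSeries fun d ↦ ((d : ℤ) ^ 5 - (d : ℤ) ^ 3) / 2, ?_⟩
    have h2 := divisorSeries_const_mul 2 fun d ↦ ((d : ℤ) ^ 5 - (d : ℤ) ^ 3) / 2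
    have hd (d : ℕ) : (2 : ℤ) ∣ (d : ℤ) ^ 5 - (d : ℤ) ^ 3 := by
      rw [← even_iff_two_dvd]
      simp [parity_simps]
    simp only [Int.mul_ediv_cancel' (hd _)] at h2
    rw [show (2 : ℤ⟦X⟧) = C 2 from (map_ofNat C 2).symm, ← h2, sigmaSeries, sigmaSeries,
      ← divisorSeries_add]
    simp
  have hW : divisorSeries deltaWeight =
      divisorSeries (fun d ↦ (5 * (d : ℤ) ^ 3 + 7 * (d : ℤ) ^ 5) / 12) + sigmaSeries 3 ^ 2 := by
    have h : (120 : ℤ⟦X⟧) ≠ 0 := fun h ↦ by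
      have h0 := congrArg constantCoeff h
      rw [map_ofNat, map_zero] at h0
      norm_num at h0
    refine mul_left_cancel₀ h ?_
    have h1 := divisorSeries_const_mul 120 deltaWeight
    have h70 := divisorSeries_const_mul 70 fun d ↦ (d : ℤ) ^ 5
    have h49 := divisorSeries_const_mul 49 fun d ↦ (d : ℤ) ^ 3
    simp only [mul_deltaWeight, divisorSeries_add, h70, h49, map_ofNat] at h1
    rw [mul_add, mul_sigmaSeries_sq, ← h1]
    change sigmaSeries 7 + 70 * sigmaSeries 5 + 49 * sigmaSeries 3 = _
    linear_combination -10 * twelve_mul_divisorSeries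
  refine ⟨2000 * sigmaSeries 3 ^ 3 - 12 * sigmaSeries 3 ^ 2 - 147 * sigmaSeries 3 * Z -
    147 * Z ^ 2, ?_⟩
  rw [hW, deltaSeries, hZ]
  ring

theorem deltaSeries_coeff_mod_two (n : ℕ) :
    (deltaSeries.coeff n : ZMod 2) = ∑ d ∈ n.divisors, if 4 ∣ d then 0 else 1 := by
  obtain ⟨Y, hY⟩ := deltaSeries_eq
  rw [hY, map_add, show (4 : ℤ⟦X⟧) = C 4 from (map_ofNat C 4).symm, coeff_C_mul,
    coeff_divisorSeries]
  push_cast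
  rw [show (4 : ZMod 2) = 0 from rfl, zero_mul, add_zero]
  exact sum_congr rfl fun d _ ↦ deltaWeight_mod_two d

/-- `τ(ℓ) ≡ 1 + ℓ` modulo `4` for odd primes `ℓ`. -/
theorem deltaSeries_coeff_prime {ℓ : ℕ} (hℓ : ℓ.Prime) (h2 : ℓ ≠ 2) :
    (deltaSeries.coeff ℓ : ZMod 4) = 1 + ℓ := by
  obtain ⟨Y, hY⟩ := deltaSeries_eq
  rw [hY, map_add, show (4 : ℤ⟦X⟧) = C 4 from (map_ofNat C 4).symm, coeff_C_mul,
    coeff_divisorSeries, hℓ.sum_divisors]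
  push_cast
  rw [show (4 : ZMod 4) = 0 from rfl, zero_mul, add_zero, deltaWeight_of_odd odd_one,
    deltaWeight_of_odd (hℓ.odd_of_ne_two h2), Nat.cast_one, add_comm]

/-- The divisors `d` and `2 * d`, for `d` odd, cancel. -/
theorem deltaSeries_coeff_of_even {n : ℕ} (hn : Even n) : (deltaSeries.coeff n : ZMod 2) = 0 := by
  rw [deltaSeries_coeff_mod_two]
  refine sum_involution
    (fun d _ ↦ if 4 ∣ d then d else if 2 ∣ d then d / 2 else 2 * d) ?_ ?_ ?_ ?_
  · intro d _
    split_ifs <;> first | rfl | omega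
  · intro d _ h
    split_ifs at h ⊢ <;> first | exact absurd rfl h | omega
  · intro d hd
    rw [Nat.mem_divisors] at hd ⊢
    refine ⟨?_, hd.2⟩
    split_ifs with h4 h2
    · exact hd.1
    · exact (Nat.div_dvd_of_dvd h2).trans hd.1
    · exact (Nat.prime_two.coprime_iff_not_dvd.2 h2).mul_dvd_of_dvd_of_dvd hn.two_dvd hd.1
  · intro d _
    split_ifs <;> omega

theorem sigmaSeries_coeff_of_odd {n : ℕ} (hn : Odd n) (k : ℕ) :
    ((sigmaSeries k).coeff n : ZMod 2) = ∑ _d ∈ n.divisors, 1 := by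
  rw [coeff_sigmaSeries]
  push_cast
  refine sum_congr rfl fun d hd ↦ ?_
  have : Odd d := hn.of_dvd_nat (Nat.dvd_of_mem_divisors hd)
  rw [show (d : ZMod 2) = 1 from ZMod.natCast_eq_one_iff_odd.2 this, one_pow]

theorem deltaSeries_coeff_of_odd {n : ℕ} (hn : Odd n) (k : ℕ) :
    (deltaSeries.coeff n : ZMod 2) = ((sigmaSeries k).coeff n : ZMod 2) := by
  rw [sigmaSeries_coeff_of_odd hn, deltaSeries_coeff_mod_two]
  refine sum_congr rfl fun d hd ↦ if_neg fun h ↦ ?_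
  have : Odd d := hn.of_dvd_nat (Nat.dvd_of_mem_divisors hd)
  exact Nat.not_even_iff_odd.2 this (even_iff_two_dvd.2 ((by norm_num : 2 ∣ 4).trans h))

/-- For `k ≥ 1` and odd `m`, `σ_k(2 * m) = (1 + 2 ^ k) * σ_k(m)` has the parity of `σ_k(m)`. -/
theorem sigmaSeries_coeff_two_mul {m k : ℕ} (hm : Odd m) (hk : k ≠ 0) :
    ((sigmaSeries k).coeff (2 * m) : ZMod 2) = ((sigmaSeries k).coeff m : ZMod 2) := by
  have h (n : ℕ) : (sigmaSeries k).coeff n = (ArithmeticFunction.sigma k n : ℤ) := by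
    simp [coeff_sigmaSeries, ArithmeticFunction.sigma_apply]
  rw [h, h, ArithmeticFunction.isMultiplicative_sigma.map_mul_of_coprime
    (Nat.coprime_two_left.2 hm), ArithmeticFunction.sigma_apply, Nat.prime_two.sum_divisors]
  push_cast
  rw [show (2 : ZMod 2) = 0 from rfl, zero_pow hk]
  ring

/-- Modulo `2`, the series `Δ` is supported on the odd squares: pair `d` with `n / d`. -/
theorem mod_eight_of_deltaSeries_coeff_ne_zero {n : ℕ} (h : (deltaSeries.coeff n : ZMod 2) ≠ 0) :
    n % 8 = 1 := by
  have hn : Odd n := by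
    rw [← Nat.not_even_iff_odd]
    exact fun hn ↦ h (deltaSeries_coeff_of_even hn)
  by_contra h8
  refine h ?_
  rw [deltaSeries_coeff_of_odd hn 3, sigmaSeries_coeff_of_odd hn]
  refine sum_involution (fun d _ ↦ n / d) (fun _ _ ↦ rfl) ?_ ?_ ?_
  · intro d hd _ hnd
    have hsq : d * d = n := by
      have := Nat.div_mul_cancel (Nat.dvd_of_mem_divisors hd)
      rwa [hnd] at this
    have hd2 : Odd d := hn.of_dvd_nat (Nat.dvd_of_mem_divisors hd)
    have key : ∀ r < 8, r % 2 = 1 → r * r % 8 = 1 := by decide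
    refine h8 ?_
    rw [← hsq, Nat.mul_mod]
    exact key _ (Nat.mod_lt _ (by norm_num))
      (by rw [Nat.mod_mod_of_dvd _ (by norm_num), Nat.odd_iff.1 hd2])
  · intro d hd
    exact Nat.mem_divisors.2 ⟨Nat.div_dvd_of_dvd (Nat.dvd_of_mem_divisors hd), hn.pos.ne'⟩
  · intro d hd
    exact Nat.div_div_self (Nat.dvd_of_mem_divisors hd) hn.pos.ne'

/-- `Δ(q) ^ 2 ≡ Δ(q ^ 2)` modulo `2`. -/
theorem deltaSeries_sq_coeff (n : ℕ) : ((deltaSeries ^ 2).coeff n : ZMod 2) =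
    if 2 ∣ n then (deltaSeries.coeff (n / 2) : ZMod 2) else 0 := by
  have h := MvPowerSeries.map_frobenius_expand (p := 2) two_ne_zero
    (f := (deltaSeries.map (Int.castRingHom (ZMod 2)) : MvPowerSeries Unit (ZMod 2)))
  rw [ZMod.frobenius_zmod, MvPowerSeries.map_id] at h
  have h1 := congrArg (PowerSeries.coeff n) h
  have h2 := coeff_expand 2 two_ne_zero (deltaSeries.map (Int.castRingHom (ZMod 2))) (n := n)
  have h3 : coeff n (deltaSeries.map (Int.castRingHom (ZMod 2)) ^ 2) =
    ((deltaSeries ^ 2).coeff n : ZMod 2) := by rw [← map_pow, coeff_map]; rfl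
  rw [← h3]
  refine h1.symm.trans (h2.trans ?_)
  simp

/-- Modulo `2`, the coefficient of `q ^ ℓ` in `Δ ^ 3` counts the solutions of
`x ^ 2 + 2 * y ^ 2 = ℓ` in odd positive integers. Its parity is read off from the convolution
`∑ σ₃(i) σ₃(ℓ - i) = (σ₇(ℓ) - σ₃(ℓ)) / 120`. -/
theorem deltaSeries_cube_coeff_prime {ℓ : ℕ} (hℓ : ℓ.Prime) (h2 : ℓ ≠ 2) :
    ((deltaSeries ^ 3).coeff ℓ : ZMod 2) = if ℓ % 8 = 3 then 1 else 0 := by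
  have hodd : Odd ℓ := hℓ.odd_of_ne_two h2
  have hodd' := Nat.odd_iff.1 hodd
  rw [pow_succ', coeff_mul]
  push_cast
  split_ifs with h3
  · set s : ℕ → ℤ := fun n ↦ (sigmaSeries 3).coeff n with hs
    set N : ℤ := ∑ p ∈ antidiagonal ℓ with Odd p.1, s p.1 * s p.2 with hN
    -- If `i` is odd and the term at `i` is odd, then `i ≡ 1` modulo `8`, so that `ℓ - i = 2 * m`
    -- with `m` odd, and `τ` may be replaced by `σ₃` at both `i` and `m`.
    have hterm : ∀ p ∈ antidiagonal ℓ,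
        (deltaSeries.coeff p.1 : ZMod 2) * ((deltaSeries ^ 2).coeff p.2 : ZMod 2) =
          if Odd p.1 then ((s p.1 * s p.2 : ℤ) : ZMod 2) else 0 := by
      rintro ⟨i, j⟩ hp
      rw [HasAntidiagonal.mem_antidiagonal] at hp
      simp only at hp ⊢
      split_ifs with hi
      · push_cast
        rw [deltaSeries_coeff_of_odd hi 3]
        by_cases h0 : (s i : ZMod 2) = 0
        · simp only [hs] at h0 ⊢
          rw [h0, zero_mul, zero_mul]
        · have hi8 := mod_eight_of_deltaSeries_coeff_ne_zero
            ((deltaSeries_coeff_of_odd hi 3).trans_ne h0)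
          obtain ⟨m, rfl⟩ : 2 ∣ j := by omega
          have hm : Odd m := Nat.odd_iff.2 (by omega)
          rw [deltaSeries_sq_coeff, if_pos (dvd_mul_right _ _), Nat.mul_div_cancel_left _ two_pos,
            deltaSeries_coeff_of_odd hm 3, ← sigmaSeries_coeff_two_mul hm three_ne_zero]
      · rw [deltaSeries_coeff_of_even (Nat.not_odd_iff_even.1 hi), zero_mul]
    rw [sum_congr rfl hterm, ← sum_filter, ← Int.cast_sum, ← hN]
    -- Swapping `i` and `ℓ - i`, exactly one of which is odd, halves the convolution.
    have h2N : (sigmaSeries 3 ^ 2).coeff ℓ = 2 * N := by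
      rw [sq, coeff_mul, ← sum_filter_add_sum_filter_not _ (fun p ↦ Odd p.1), two_mul]
      congr 1
      refine sum_nbij' Prod.swap Prod.swap ?_ ?_ ?_ ?_ ?_
      · rintro ⟨i, j⟩ h
        simp only [mem_filter, HasAntidiagonal.mem_antidiagonal, Prod.swap] at h ⊢
        refine ⟨by omega, ?_⟩
        rw [Nat.odd_iff] at h ⊢
        omega
      · rintro ⟨i, j⟩ h
        simp only [mem_filter, HasAntidiagonal.mem_antidiagonal, Prod.swap] at h ⊢
        refine ⟨by omega, ?_⟩
        rw [Nat.odd_iff] at h ⊢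
        omega
      · simp
      · simp
      · rintro ⟨i, j⟩ h
        exact mul_comm _ _
    have hconv := congrArg (coeff ℓ) mul_sigmaSeries_sq
    rw [show (120 : ℤ⟦X⟧) = C 120 from (map_ofNat C 120).symm, coeff_C_mul, h2N, map_sub,
      coeff_sigmaSeries, coeff_sigmaSeries, hℓ.sum_divisors, hℓ.sum_divisors] at hconv
    -- `240 * N = ℓ ^ 7 - ℓ ^ 3`, and `16` divides `240` exactly.
    have key : ∀ e : ZMod 32, e.val % 8 = 3 → e ^ 7 - e ^ 3 = 16 := by decide +kernel
    have h32 := key ℓ (by rw [ZMod.val_natCast, Nat.mod_mod_of_dvd _ (by norm_num), h3])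
    have h32' : (((ℓ : ℤ) ^ 7 - (ℓ : ℤ) ^ 3 - 16 : ℤ) : ZMod 32) = 0 := by
      push_cast
      rw [h32, sub_self]
    rw [ZMod.intCast_zmod_eq_zero_iff_dvd] at h32'
    have hNodd : ((N - 1 : ℤ) : ZMod 2) = 0 := by
      rw [ZMod.intCast_zmod_eq_zero_iff_dvd]
      push_cast at h32' hconv ⊢
      omega
    push_cast at hNodd
    exact sub_eq_zero.1 hNodd
  · -- A nonzero term needs `i ≡ 1` and `(ℓ - i) / 2 ≡ 1` modulo `8`.
    refine sum_eq_zero ?_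
    rintro ⟨i, j⟩ hp
    rw [HasAntidiagonal.mem_antidiagonal] at hp
    by_contra h
    have hi := mod_eight_of_deltaSeries_coeff_ne_zero (left_ne_zero_of_mul h)
    have hj := right_ne_zero_of_mul h
    rw [deltaSeries_sq_coeff] at hj
    split_ifs at hj with hj2
    · have := mod_eight_of_deltaSeries_coeff_ne_zero hj
      simp only at hp hi hj2 this
      omega
    · exact hj rfl

/-- Modulo `4` one has `f ≡ Δ + 2 * Δ ^ 3`, since `E₄ ≡ 1`. -/
theorem fSeries_coeff_prime {ℓ : ℕ} (hℓ : ℓ.Prime) (h2 : ℓ ≠ 2) :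
    (fSeries.coeff ℓ : ZMod 4) = if ℓ % 8 = 7 then 0 else 2 := by
  obtain ⟨Z, hZ⟩ : ∃ Z : ℤ⟦X⟧, fSeries = deltaSeries + 2 * deltaSeries ^ 3 + 4 * Z := by
    obtain ⟨W, hW⟩ := sub_dvd_pow_sub_pow e4Series 1 6
    refine ⟨60 * sigmaSeries 3 * W * deltaSeries, ?_⟩
    rw [one_pow, sub_eq_iff_eq_add] at hW
    rw [fSeries, hW, e4Series]
    ring
  have hcube : (2 * (deltaSeries ^ 3).coeff ℓ : ZMod 4) = if ℓ % 8 = 3 then 2 else 0 := by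
    have h := deltaSeries_cube_coeff_prime hℓ h2
    have h4 : (4 : ZMod 4) = 0 := rfl
    split_ifs at h ⊢
    · have h' : (((deltaSeries ^ 3).coeff ℓ - 1 : ℤ) : ZMod 2) = 0 := by
        push_cast
        rw [h, sub_self]
      rw [ZMod.intCast_zmod_eq_zero_iff_dvd] at h'
      obtain ⟨c, hc⟩ := h'
      rw [sub_eq_iff_eq_add.1 hc]
      push_cast
      linear_combination (c : ZMod 4) * h4
    · rw [ZMod.intCast_zmod_eq_zero_iff_dvd] at h
      obtain ⟨c, hc⟩ := h
      rw [hc]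
      push_cast
      linear_combination (c : ZMod 4) * h4
  rw [hZ, map_add, map_add, show (4 : ℤ⟦X⟧) = C 4 from (map_ofNat C 4).symm, coeff_C_mul,
    show (2 : ℤ⟦X⟧) = C 2 from (map_ofNat C 2).symm, coeff_C_mul]
  push_cast
  rw [hcube, deltaSeries_coeff_prime hℓ h2, show (4 : ZMod 4) = 0 from rfl, zero_mul, add_zero]
  have h4 : (ℓ : ZMod 4) = ((ℓ % 8 : ℕ) : ZMod 4) := by
    rw [ZMod.natCast_eq_natCast_iff', Nat.mod_mod_of_dvd _ (by norm_num)]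
  have h8 : ℓ % 8 < 8 := Nat.mod_lt _ (by norm_num)
  have hodd : ℓ % 8 % 2 = 1 := by
    rw [Nat.mod_mod_of_dvd _ (by norm_num)]
    exact Nat.odd_iff.1 (hℓ.odd_of_ne_two h2)
  rw [h4]
  generalize ℓ % 8 = r at *
  interval_cases r <;> first | rfl | omega

end

open NumberField

/-! ### Algebraic integers modulo primes above an odd prime -/

theorem two_pow_notMem {Qbar : Type*} [Field Qbar] {ℓ : ℕ} (hℓ : ℓ.Prime) (h2 : ℓ ≠ 2)
    (Q : Ideal (𝓞 Qbar)) [Q.IsPrime] [Q.LiesOver (Ideal.span {(ℓ : ℤ)})] (n : ℕ) :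
    (2 : 𝓞 Qbar) ^ n ∉ Q := by
  intro h
  have h : ((2 ^ n : ℤ) : 𝓞 Qbar) ∈ Q := by exact_mod_cast h
  have h' : (2 ^ n : ℤ) ∈ Ideal.span {(ℓ : ℤ)} := by
    rw [Ideal.mem_of_liesOver Q (Ideal.span {(ℓ : ℤ)})]
    simpa using h
  rw [Ideal.mem_span_singleton] at h'
  have h'' : ℓ ∣ 2 ^ n := by exact_mod_cast h'
  exact h2 ((Nat.prime_dvd_prime_iff_eq hℓ Nat.prime_two).1 (hℓ.dvd_of_dvd_pow h''))

/-- If `y` divides a power of `2` and `σ y = -y` for some `σ` in the inertia group of `Q`, then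
`2 * y = y - σ y` lies in `Q`, and so does a power of `2`. -/
theorem apply_eq_of_mem_inertia {Qbar : Type*} [Field Qbar] [Algebra ℚ Qbar] {ℓ : ℕ} (hℓ : ℓ.Prime)
    (h2 : ℓ ≠ 2) (Q : Ideal (𝓞 Qbar)) [Q.IsPrime] [Q.LiesOver (Ideal.span {(ℓ : ℤ)})]
    {σ : Gal(Qbar/ℚ)} (hσ : σ ∈ Q.inertia Gal(Qbar/ℚ)) {y z : Qbar} (hy : IsIntegral ℤ y)
    (hz : IsIntegral ℤ z) {n : ℕ} (hyz : y * z = 2 ^ n) (h : σ y = y ∨ σ y = -y) : σ y = y := by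
  refine h.resolve_right fun hneg ↦ ?_
  obtain ⟨Y, hY⟩ : ∃ Y : 𝓞 Qbar, (Y : Qbar) = y := ⟨⟨y, hy⟩, rfl⟩
  obtain ⟨Z, hZ⟩ : ∃ Z : 𝓞 Qbar, (Z : Qbar) = z := ⟨⟨z, hz⟩, rfl⟩
  subst hY hZ
  have hYZ' : algebraMap (𝓞 Qbar) Qbar (Y * Z) = algebraMap (𝓞 Qbar) Qbar (2 ^ n) := by
    rw [map_mul, map_pow, map_ofNat]
    exact hyz
  have hYZ : Y * Z = 2 ^ n := RingOfIntegers.ext hYZ'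
  have hσY : σ • Y = -Y := RingOfIntegers.ext (hneg.trans (map_neg _ _).symm)
  have h1 : σ • Y - Y ∈ Q := hσ Y
  have h3 : (2 : 𝓞 Qbar) ^ (n + 1) = -(Z * (σ • Y - Y)) := by
    rw [hσY]
    linear_combination -2 * hYZ
  refine two_pow_notMem hℓ h2 Q (n + 1) ?_
  rw [h3]
  exact neg_mem (Q.mul_mem_left _ h1)

namespace Radicals

section

variable {Qbar : Type*} [Field Qbar] (x : Radicals Qbar)

theorem isIntegral_i : IsIntegral ℤ x.i :=
  .of_pow two_pos (by rw [x.i_sq]; exact isIntegral_one.neg)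

theorem isIntegral_sqrtTwo : IsIntegral ℤ x.sqrtTwo :=
  .of_pow two_pos (by rw [x.sqrtTwo_sq]; exact isIntegral_natCast 2)

theorem isIntegral_sqrtOneAddI : IsIntegral ℤ x.sqrtOneAddI :=
  .of_pow two_pos (by rw [x.sqrtOneAddI_sq]; exact isIntegral_one.add x.isIntegral_i)

end

variable {Qbar : Type*} [Field Qbar] [Algebra ℚ Qbar] [IsAlgClosure ℚ Qbar] (x : Radicals Qbar)

theorem isUnramifiedAt_rho {ℓ : ℕ} (hℓ : ℓ.Prime) (h2 : ℓ ≠ 2) : IsUnramifiedAt x.rho ℓ := by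
  intro Q _ _ σ hσ
  have hi : σ x.i = x.i := by
    refine apply_eq_of_mem_inertia hℓ h2 Q hσ x.isIntegral_i x.isIntegral_i.neg (n := 0) ?_ ?_
    · linear_combination -x.i_sq
    · exact (x.apply_cases σ).2.imp (·.1) (·.1)
  have ht : σ x.sqrtTwo = x.sqrtTwo := by
    refine apply_eq_of_mem_inertia hℓ h2 Q hσ x.isIntegral_sqrtTwo x.isIntegral_sqrtTwo (n := 1)
      ?_ (x.apply_cases σ).1
    linear_combination x.sqrtTwo_sq
  have hg : σ x.sqrtOneAddI = x.sqrtOneAddI := by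
    refine apply_eq_of_mem_inertia hℓ h2 Q hσ x.isIntegral_sqrtOneAddI
      (x.isIntegral_sqrtOneAddI.mul (isIntegral_one.sub x.isIntegral_i)) (n := 1) ?_ ?_
    · linear_combination (1 - x.i) * x.sqrtOneAddI_sq - x.i_sq
    · rcases (x.apply_cases σ).2 with h | ⟨h, -⟩
      · exact h.2
      · exact absurd (Subtype.ext (hi.symm.trans h)) x.iK_ne_neg
  have hres : AlgEquiv.restrictNormalHom x.K σ = 1 := by
    refine x.gal_ext ?_ ?_ ?_ <;>
      simp only [Subtype.ext_iff, AlgEquiv.restrictNormalHom_apply, AlgEquiv.one_apply]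
    exacts [hi, ht, hg]
  rw [MonoidHom.mem_ker]
  simp [rho, hres]

/-! ### The trace of `ρ` -/

theorem trace_matRep (g : DihedralGroup 4) :
    Matrix.trace (matRep g : Matrix (Fin 2) (Fin 2) (ZMod 4)) =
      if g = .sr 1 ∨ g = .sr 3 then 0 else 2 := by
  revert g
  decide

/-- The elements of `D₄` where the trace vanishes are those that act as `i ↦ -i`, `√2 ↦ √2`. -/
theorem dihedralToGal_apply_iff (g : DihedralGroup 4) :
    (x.dihedralToGal g x.iK = -x.iK ∧ x.dihedralToGal g x.sqrtTwoK = x.sqrtTwoK) ↔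
      g = .sr 1 ∨ g = .sr 3 := by
  obtain ⟨hi, ht, -⟩ := x.autR_spec
  obtain ⟨hi', ht', -⟩ := x.autS_spec
  have n1 := x.iK_ne_neg
  have n2 := x.sqrtTwoK_ne_neg
  have hr (k : ZMod 4) : x.dihedralToGal (.r k) = x.autR ^ k.val := rfl
  have hs (k : ZMod 4) : x.dihedralToGal (.sr k) = x.autS * x.autR ^ k.val := rfl
  have v0 : ZMod.val (0 : ZMod 4) = 0 := rfl
  have v1 : ZMod.val (1 : ZMod 4) = 1 := rfl
  have v2 : ZMod.val (2 : ZMod 4) = 2 := rfl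
  have v3 : ZMod.val (3 : ZMod 4) = 3 := rfl
  rcases g with k | k
  · rw [hr]
    obtain rfl | rfl | rfl | rfl : k = 0 ∨ k = 1 ∨ k = 2 ∨ k = 3 := by revert k; decide
    all_goals simp +decide [pow_succ, v1, v2, v3, hi, ht, n1, n2.symm]
  · rw [hs]
    obtain rfl | rfl | rfl | rfl : k = 0 ∨ k = 1 ∨ k = 2 ∨ k = 3 := by revert k; decide
    all_goals simp +decide [pow_succ, v1, v2, v3, hi, ht, hi', ht', n1]

open Classical in
theorem trace_rho (σ : Gal(Qbar/ℚ)) :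
    Matrix.trace (x.rho σ : Matrix (Fin 2) (Fin 2) (ZMod 4)) =
      if σ x.i = -x.i ∧ σ x.sqrtTwo = x.sqrtTwo then 0 else 2 := by
  set τ := AlgEquiv.restrictNormalHom x.K σ with hτ
  have hg : x.dihedralToGal (x.galEquiv τ) = τ :=
    (MulEquiv.ofBijective x.dihedralToGal x.dihedralToGal_bijective).apply_symm_apply τ
  have h := x.dihedralToGal_apply_iff (x.galEquiv τ)
  rw [hg] at h
  simp only [Subtype.ext_iff, hτ, AlgEquiv.restrictNormalHom_apply] at h
  refine (trace_matRep (x.galEquiv τ)).trans (if_congr (h.symm.trans ?_) rfl rfl)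
  rfl

/-- A Frobenius element at `ℓ` acts on the eighth roots of unity by `ζ ↦ ζ ^ ℓ`, which determines
its action on `i = ζ ^ 2` and on `√2 = ζ + ζ⁻¹`. -/
theorem apply_of_isFrobeniusAt {ℓ : ℕ} (hℓ : ℓ.Prime) (h2 : ℓ ≠ 2) {σ : Gal(Qbar/ℚ)}
    (hσ : IsFrobeniusAt σ ℓ) :
    (σ x.i = -x.i ∧ σ x.sqrtTwo = x.sqrtTwo) ↔ ℓ % 8 = 7 := by
  have : CharZero Qbar := algebraRat.charZero Qbar
  obtain ⟨Q, _, _, hQ⟩ := hσ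
  have ht0 := x.sqrtTwo_ne_zero
  have ht2 := x.sqrtTwo_sq
  have hi2 := x.i_sq
  -- The primitive eighth root of unity with `ζ ^ 2 = i` and `ζ - ζ ^ 3 = √2`.
  set ζ := (1 + x.i) / x.sqrtTwo with hζ
  have hζ2 : ζ ^ 2 = x.i := by
    rw [hζ, div_pow, ht2]
    linear_combination (1 / 2) * hi2
  have hζ8 : ζ ^ 8 = 1 := by
    rw [show 8 = 2 * 4 from rfl, pow_mul, hζ2]
    linear_combination (x.i ^ 2 - 1) * hi2
  have hζt : x.sqrtTwo = ζ - ζ ^ 3 := by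
    rw [pow_succ, hζ2, hζ]
    field_simp
    linear_combination ht2 + hi2
  have hint : IsIntegral ℤ ζ := .of_pow (n := 8) (by norm_num) (by rw [hζ8]; exact isIntegral_one)
  have hcard : Nat.card (ℤ ⧸ Q.under ℤ) = ℓ := by
    rw [← Ideal.LiesOver.over (p := Ideal.span {(ℓ : ℤ)}) (P := Q),
      Nat.card_congr (Int.quotientSpanNatEquivZMod ℓ).toEquiv, Nat.card_zmod]
  have h8 : ((8 : ℕ) : 𝓞 Qbar) ∉ Q := by
    have := two_pow_notMem hℓ h2 Q 3
    norm_num at this ⊢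
    exact this
  have hfrob : σ ζ = ζ ^ ℓ := by
    have h := hQ.apply_of_pow_eq_one (ζ := (⟨ζ, hint⟩ : 𝓞 Qbar)) (m := 8)
      (RingOfIntegers.ext hζ8) h8
    rw [hcard] at h
    exact congrArg (algebraMap (𝓞 Qbar) Qbar) h
  have hi : σ x.i = x.i ^ ℓ := by rw [← hζ2, map_pow, hfrob, ← pow_mul, ← pow_mul, mul_comm]
  have ht : σ x.sqrtTwo = ζ ^ ℓ - ζ ^ (3 * ℓ) := by
    rw [hζt, map_sub, map_pow, hfrob, ← pow_mul, mul_comm]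
  have hζ4 : ζ ^ 4 = -1 := by rw [show 4 = 2 * 2 from rfl, pow_mul, hζ2, hi2]
  have hi0 : x.i ≠ 0 := fun h ↦ by simp [h] at hi2
  have hodd := Nat.odd_iff.1 (hℓ.odd_of_ne_two h2)
  rw [hi, ht, ← hζ2, hζt, ← pow_mul, pow_eq_pow_mod (2 * ℓ) hζ8, pow_eq_pow_mod ℓ hζ8,
    pow_eq_pow_mod (3 * ℓ) hζ8]
  have hne : ζ ^ 2 ≠ -ζ ^ 2 := by rw [hζ2]; exact self_ne_neg.2 hi0
  have hne' : ζ - ζ ^ 3 ≠ -(ζ - ζ ^ 3) := by rw [← hζt]; exact self_ne_neg.2 ht0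
  obtain h | h | h | h : ℓ % 8 = 1 ∨ ℓ % 8 = 3 ∨ ℓ % 8 = 5 ∨ ℓ % 8 = 7 := by omega
  · rw [show 2 * ℓ % 8 = 2 by omega, h]
    simp [hne]
  · rw [show 3 * ℓ % 8 = 1 by omega, h]
    have : ζ ^ 3 - ζ ^ 1 = -(ζ - ζ ^ 3) := by ring
    rw [this]
    exact iff_of_false (fun h' ↦ hne'.symm h'.2) (by norm_num)
  · rw [show 2 * ℓ % 8 = 2 by omega, h]
    simp [hne]
  · rw [show 2 * ℓ % 8 = 6 by omega, show 3 * ℓ % 8 = 5 by omega, h]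
    refine iff_of_true ⟨?_, ?_⟩ rfl
    · linear_combination ζ ^ 2 * hζ4
    · linear_combination (ζ ^ 3 - ζ) * hζ4

end Radicals
end D4Galois

theorem proposition3p8 {Qbar : Type*} [Field Qbar] [Algebra ℚ Qbar] [IsAlgClosure ℚ Qbar]
    (x : D4Galois.Radicals Qbar) :
    (∀ ℓ : ℕ, ℓ.Prime → ℓ ≠ 2 → D4Galois.IsUnramifiedAt x.rho ℓ) ∧
    (∀ ℓ : ℕ, ℓ.Prime → ℓ ≠ 2 → ∃ c : ℤ, D4Galois.a ℓ D4Galois.f = (c : ℂ) ∧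
      ∀ σ : Gal(Qbar/ℚ), D4Galois.IsFrobeniusAt σ ℓ →
        Matrix.trace (x.rho σ : Matrix (Fin 2) (Fin 2) (ZMod 4)) = (c : ZMod 4)) := by
  classical
  refine ⟨fun ℓ hℓ h2 ↦ x.isUnramifiedAt_rho hℓ h2, fun ℓ hℓ h2 ↦
    ⟨_, D4Galois.a_f ℓ, fun σ hσ ↦ ?_⟩⟩
  rw [D4Galois.Radicals.trace_rho, D4Galois.fSeries_coeff_prime hℓ h2]
  exact if_congr (x.apply_of_isFrobeniusAt hℓ h2 hσ) rfl rfl
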